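/- A \emph{polymatroid} on $[n]=\{1,\ldots,n\}$ is a function $r:2^{[n]}\to\mathbb{Z}_{\ge 0}$ with $r(\emptyset)=0$, $r(S)\le r(T)$ whenever $S\subseteq T$, and $r(S\cup T)+r(S\cap T)\le r(S)+r(T)$ for all $S,T\subseteq[n]$. Let $d=r([n])$ be its rank and put $$\overline{r}(S)=\sum_{k=0}^{d}\min(d-k,\,r(S))\qquad(S\subseteq[n]).$$ The base polytope of $\overline{r}$ is $$B(\overline{r})=\Big\{x\in(\mathbb{R}_{\ge 0})^n:\ \sum_{i\in S}x_i\le\overline{r}(S)\text{ for all }S\subseteq[n],\ \sum_{i=1}^n x_i=\overline{r}([n])\Big\}.$$ A lattice polytope $P\subset\mathbb{R}^n$ is the convex hull of a nonempty finite subset of $\mathbb{Z}^n$. Its projective toric variety over $\mathbb{C}$ is $X_P=\operatorname{Proj}\,\mathbb{C}[C(P)\cap(\mathbb{Z}^n\times\mathbb{Z})]$, where $C(P)\subset\mathbb{R}^n\times\mathbb{R}$ is the cone spanned by $P\times\{1\}$ and the semigroup ring is graded by the last coordinate. The lattice polytope $P$ is called \emph{smooth} if $X_P$ is smooth over $\mathbb{C}$.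 \textbf{Corollary.} Let $n\ge 0$ and let $r$ be a polymatroid on $[n]$. Then $B(\overline{r})$ is a smooth lattice polytope. -/

import Mathlib

noncomputable section

/-- A polymatroid on the ground set `[n]` (modelled by `Fin n`): a monotone, submodular function
`2^[n] → ℤ_{≥ 0}` that vanishes on the empty set. -/
structure IsPolymatroid {n : ℕ} (r : Finset (Fin n) → ℕ) : Prop where
  mono : ∀ S T : Finset (Fin n), S ⊆ T → r S ≤ r T
  submodular : ∀ S T : Finset (Fin n), r (S ∪ T) + r (S ∩ T) ≤ r S + r T
  empty : r ∅ = 0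

/-- The rank `d = r([n])`. -/
def polyRank {n : ℕ} (r : Finset (Fin n) → ℕ) : ℕ := r Finset.univ

/-- The `k`-th truncation `r_k(S) = min(d - k, r(S))`, used for `0 ≤ k ≤ d` only. -/
def truncation {n : ℕ} (r : Finset (Fin n) → ℕ) (k : ℕ) (S : Finset (Fin n)) : ℕ :=
  min (polyRank r - k) (r S)

/-- The function `r_0 + r_1 + ... + r_d`. -/
def truncationSum {n : ℕ} (r : Finset (Fin n) → ℕ) (S : Finset (Fin n)) : ℕ :=
  ∑ k ∈ Finset.range (polyRank r + 1), truncation r k S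

/-- The base polytope of a function `f : 2^[n] → ℝ`. -/
def basePolytope {n : ℕ} (f : Finset (Fin n) → ℝ) : Set (Fin n → ℝ) :=
  {x | (∀ i, 0 ≤ x i) ∧ (∀ S : Finset (Fin n), ∑ i ∈ S, x i ≤ f S) ∧
    ∑ i, x i = f Finset.univ}

/-- A lattice polytope: the convex hull of a nonempty finite set of points of `ℤ^n`. -/
def IsLatticePolytope {n : ℕ} (P : Set (Fin n → ℝ)) : Prop :=
  ∃ A : Finset (Fin n → ℤ), A.Nonempty ∧
    P = convexHull ℝ ((fun (m : Fin n → ℤ) (i : Fin n) => (m i : ℝ)) '' (A : Set (Fin n → ℤ)))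

/-- The cone `C(P) ⊆ ℝ^n × ℝ` spanned by `P × {1}`. -/
def coneOver {n : ℕ} (P : Set (Fin n → ℝ)) : PointedCone ℝ ((Fin n → ℝ) × ℝ) :=
  PointedCone.hull ℝ ((fun x : Fin n → ℝ => (x, (1 : ℝ))) '' P)

/-- The inclusion `ℤ^n × ℕ → ℝ^n × ℝ`. -/
def latticeIncl (n : ℕ) : (Fin n → ℤ) × ℕ →+ (Fin n → ℝ) × ℝ where
  toFun p := (fun i => (p.1 i : ℝ), (p.2 : ℝ))
  map_zero' := by ext <;> simp
  map_add' p q := by ext <;> simp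

/-- The monoid `C(P) ∩ (ℤ^n × ℤ)` of lattice points of the cone over `P`; the last coordinate is
nonnegative on `C(P)`, so it is taken in `ℕ`. For a nonempty convex `P` its elements are the pairs
`(m, k)` with `m ∈ k P ∩ ℤ^n`. -/
def polytopeMonoid {n : ℕ} (P : Set (Fin n → ℝ)) : AddSubmonoid ((Fin n → ℤ) × ℕ) :=
  (coneOver P).toAddSubmonoid.comap (latticeIncl n)

/-- The height `(m, k) ↦ k` on the monoid of lattice points of the cone. -/
def heightHom {n : ℕ} (P : Set (Fin n → ℝ)) : polytopeMonoid P →+ ℕ :=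
  (AddMonoidHom.snd (Fin n → ℤ) ℕ).comp (polytopeMonoid P).subtype

/-- The homogeneous coordinate ring `ℂ[C(P) ∩ (ℤ^n × ℤ)]` of the polytope `P`. -/
abbrev PolytopeRing {n : ℕ} (P : Set (Fin n → ℝ)) : Type :=
  AddMonoidAlgebra ℂ (polytopeMonoid P)

/-- The grading of the polytope ring: the character `χ^(m, k)` has degree `k`. -/
abbrev polytopeGrading {n : ℕ} (P : Set (Fin n → ℝ)) : ℕ → Submodule ℂ (PolytopeRing P) :=
  AddMonoidAlgebra.gradeBy ℂ (heightHom P)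

/-- The projective toric variety `X_P` over `ℂ` of a lattice polytope `P` (of any dimension;
the lattice is the one cut out by `ℤ^n` on the affine span of `P`): `Proj` of the polytope ring. -/
def toricVariety {n : ℕ} (P : Set (Fin n → ℝ)) : AlgebraicGeometry.Scheme :=
  AlgebraicGeometry.Proj (polytopeGrading P)

/-- The structure morphism `X_P ⟶ Spec ℂ`. -/
def toricVarietyStructure {n : ℕ} (P : Set (Fin n → ℝ)) :
    toricVariety P ⟶ AlgebraicGeometry.Spec (CommRingCat.of ℂ) :=
  CategoryTheory.CategoryStruct.comp
    (AlgebraicGeometry.Proj.toSpecZero (polytopeGrading P))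
    (AlgebraicGeometry.Spec.map
      (CommRingCat.ofHom (algebraMap ℂ (polytopeGrading P 0))))

/-- A smooth lattice polytope: a lattice polytope whose toric variety `X_P` is smooth over `ℂ`. -/
structure IsSmoothLatticePolytope {n : ℕ} (P : Set (Fin n → ℝ)) : Prop where
  lattice : IsLatticePolytope P
  smooth : AlgebraicGeometry.Smooth (toricVarietyStructure P)

end

/-! Summing all truncations makes submodularity strict (`IsStrictPolymatroid`): if `S` and `T`
satisfy it with equality, the values at `S ∩ T` and `S ∪ T` are those at `S` and `T`. Smoothness
uses only this property.

The base polytope of a polymatroid is the convex hull of its greedy vertices, one for each order of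
the ground set. At such a vertex `v`, the coordinates of a lattice point `(m, k)` relative to `k •
v` are the entries `m e` where `v e = 0`, and the slacks of the inequalities at the closures of the
initial segments before each `e` with `v e ≠ 0`. They form a triangular integral system, so they
determine `m - k • v`. Strictness shows that these inequalities imply every other one tight at `v`.
Hence all nonnegative values of the coordinates that do not vanish identically occur, and the chart
monoid is free (`chart_injective_of_height`, `chart_surjective`).

So each chart of `Proj` at a greedy vertex is an affine space. The charts cover because some
multiple of any lattice point of positive height is a vertex plus a lattice point of the cone
(`exists_nsmul_eq_vertex_add`); `smooth_proj_gradeBy` concludes. -/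

open AlgebraicGeometry CategoryTheory HomogeneousLocalization

/-! ### Smoothness of `Proj` of a graded monoid algebra with free charts -/

namespace AddMonoidAlgebra

variable {R M N : Type*} [CommRing R] [AddCommMonoid M] [AddCommMonoid N]

/-- The comparison map from the degree-zero part of `R[M]` localized at the character of `v`,
induced by a monoid homomorphism that kills `v`. -/
noncomputable def awayToMonoidAlgebra (h : M →+ ℕ) (v : M) (ψ : M →+ N) (hψ : ψ v = 0) :
    Away (gradeBy R h) (single v (1 : R)) →+* AddMonoidAlgebra R N :=
  (IsLocalization.Away.lift (S := Localization.Away (single v (1 : R))) (single v (1 : R))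
    (g := mapDomainRingHom R ψ) (by simp [hψ, ← one_def])).comp
    (algebraMap (Away (gradeBy R h) (single v (1 : R))) (Localization.Away (single v (1 : R))))

theorem awayToMonoidAlgebra_mk (h : M →+ ℕ) (v : M) (ψ : M →+ N) (hψ : ψ v = 0) {d : ℕ}
    (hd : single v (1 : R) ∈ gradeBy R h d) (k : ℕ) (a : AddMonoidAlgebra R M)
    (ha : a ∈ gradeBy R h (k • d)) :
    awayToMonoidAlgebra h v ψ hψ (Away.mk _ hd k a ha) = mapDomain ψ a := by
  have h1 : mapDomainRingHom R ψ (single v (1 : R)) = 1 := by simp [hψ, ← one_def]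
  simp only [awayToMonoidAlgebra, RingHom.comp_apply, HomogeneousLocalization.algebraMap_apply,
    Away.val_mk, Localization.mk_eq_mk']
  erw [IsLocalization.lift_mk'_spec]
  simp only [map_pow, h1, one_pow, one_mul]
  rfl

/-- A degree-zero fraction is `a / χ^(k v)` with all of `a` in height `k`, and there `ψ` is
injective. Since `v` has height one, `χ^m / χ^(h m • v)` has degree zero and maps to the character
of `ψ m`. -/
theorem awayToMonoidAlgebra_bijective (h : M →+ ℕ) (v : M) (hv : h v = 1) (ψ : M →+ N)
    (hψ : ψ v = 0) (hsurj : Function.Surjective ψ)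
    (hinj : ∀ a b, h a = h b → ψ a = ψ b → a = b) :
    Function.Bijective (awayToMonoidAlgebra (R := R) h v ψ hψ) := by
  have hd : single v (1 : R) ∈ gradeBy R h 1 := hv ▸ single_mem_gradeBy h v 1
  constructor
  · rw [injective_iff_map_eq_zero]
    intro x hx
    obtain ⟨k, a, ha, rfl⟩ := Away.mk_surjective _ hd x
    rw [awayToMonoidAlgebra_mk] at hx
    have : a = 0 := by
      have hsub : ∀ m ∈ a.coeff.support, h m = k := fun m hm ↦ by simpa using ha m hm
      refine AddMonoidAlgebra.coeff_injective
        (Finsupp.mapDomain_injOn (a.coeff.support : Set M) (f := ψ)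
          (fun x hx y hy hxy ↦ hinj x y ((hsub x hx).trans (hsub y hy).symm) hxy)
          (by simp) (by simp) ?_)
      simpa using congrArg coeff hx
    subst this
    exact HomogeneousLocalization.mk_eq_zero_of_num _ rfl
  · intro y
    induction y using AddMonoidAlgebra.induction_linear with
    | zero => exact ⟨0, map_zero _⟩
    | add f g hf hg =>
      obtain ⟨a, rfl⟩ := hf
      obtain ⟨b, rfl⟩ := hg
      exact ⟨a + b, map_add _ _ _⟩
    | single n c =>
      obtain ⟨m, rfl⟩ := hsurj n
      refine ⟨Away.mk _ hd (h m) (single m c) ?_, ?_⟩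
      · simpa using single_mem_gradeBy h m c
      · rw [awayToMonoidAlgebra_mk, mapDomain_single]

end AddMonoidAlgebra

/-- A morphism property that is local for ring homomorphisms can be checked on the charts `D₊(f i)`
of `Proj 𝒜`. -/
theorem AlgebraicGeometry.Proj.of_iSup_basicOpen_eq_top {σ A : Type} [CommRing A] [SetLike σ A]
    [AddSubgroupClass σ A] (𝒜 : ℕ → σ) [GradedRing 𝒜] {P : MorphismProperty Scheme.{0}}
    {Q : ∀ {R S : Type} [CommRing R] [CommRing S], (R →+* S) → Prop} [HasRingHomProperty P Q]
    {ι : Type} (f : ι → A) (d : ι → ℕ) (hd : ∀ i, f i ∈ 𝒜 (d i)) (hpos : ∀ i, 0 < d i)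
    (hsup : ⨆ i, Proj.basicOpen 𝒜 (f i) = ⊤) {R : CommRingCat.{0}}
    (φ : R ⟶ CommRingCat.of (𝒜 0))
    (h : ∀ i, Q ((fromZeroRingHom 𝒜 (Submonoid.powers (f i))).comp φ.hom)) :
    P (Proj.toSpecZero 𝒜 ≫ Spec.map φ) := by
  refine IsZariskiLocalAtSource.of_iSup_eq_top (P := P) _ hsup fun i ↦ ?_
  rw [← MorphismProperty.cancel_left_of_respectsIso P
    (Proj.basicOpenIsoSpec 𝒜 _ (hd i) (hpos i)).inv, Proj.basicOpenIsoSpec_inv_ι_assoc,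
    Proj.awayι_toSpecZero_assoc, ← Spec.map_comp, HasRingHomProperty.Spec_iff (P := P)]
  exact h i

/-- A homogeneous prime containing every `χ^(v i)` contains `χ^m` for each `m` of positive height,
because `χ^(N m)` is a multiple of some `χ^(v i)`; it would then contain the irrelevant ideal. So
the charts at the `v i` cover, and each is an affine space over `R`. -/
theorem AddMonoidAlgebra.smooth_proj_gradeBy {R M : Type} [CommRing R] [AddCommMonoid M]
    (h : M →+ ℕ) {ι : Type} (v : ι → M) (hv : ∀ i, h (v i) = 1)
    (hcover : ∀ m, h m ≠ 0 → ∃ (i : ι) (N : ℕ) (m' : M), N • m = v i + m')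
    (J : ι → Type) [∀ i, Finite (J i)] (ψ : ∀ i, M →+ (J i →₀ ℕ)) (hψ : ∀ i, ψ i (v i) = 0)
    (hsurj : ∀ i, Function.Surjective (ψ i))
    (hinj : ∀ i a b, h a = h b → ψ i a = ψ i b → a = b) :
    Smooth (Proj.toSpecZero (gradeBy R h) ≫
      Spec.map (CommRingCat.ofHom (algebraMap R (gradeBy R h 0)))) := by
  have hd : ∀ i, single (v i) (1 : R) ∈ gradeBy R h 1 :=
    fun i ↦ hv i ▸ single_mem_gradeBy h (v i) 1
  have hsup : ⨆ i, Proj.basicOpen (gradeBy R h) (single (v i) (1 : R)) = ⊤ := by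
    refine top_le_iff.mp fun x _ ↦ TopologicalSpace.Opens.mem_iSup.mpr ?_
    by_contra! H
    simp only [Proj.mem_basicOpen, not_not] at H
    have hpos : ∀ c ≠ 0, ∀ a ∈ gradeBy R h c, a ∈ x.asHomogeneousIdeal.toIdeal := by
      intro c hc a ha
      rw [← a.sum_coeff_single]
      refine Ideal.sum_mem _ fun m hm ↦ ?_
      obtain ⟨i, N, m', hN⟩ := hcover m (by rwa [ha m hm])
      have h1 : single m (1 : R) ∈ x.asHomogeneousIdeal.toIdeal := by
        refine x.isPrime.mem_of_pow_mem N ?_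
        rw [single_pow, hN, one_pow, ← one_mul (1 : R), ← single_mul_single]
        exact Ideal.mul_mem_right _ _ (H i)
      have h2 := Ideal.mul_mem_left _ (single 0 (a.coeff m)) h1
      rwa [single_mul_single, zero_add, mul_one] at h2
    refine x.not_irrelevant_le fun a ha ↦ ?_
    classical
    rw [← DirectSum.sum_support_decompose (gradeBy R h) a]
    refine Ideal.sum_mem _ fun c _ ↦ ?_
    rcases eq_or_ne c 0 with rfl | hc
    · rw [← GradedRing.proj_apply, (HomogeneousIdeal.mem_irrelevant_iff _ _).1 ha]
      exact zero_mem _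
    · exact hpos c hc _ (SetLike.coe_mem _)
  refine Proj.of_iSup_basicOpen_eq_top (gradeBy R h) (P := @Smooth.{0}) _ (fun _ ↦ 1) hd
    (fun _ ↦ one_pos) hsup _ fun i ↦ ?_
  set Φ := RingEquiv.ofBijective _
    (awayToMonoidAlgebra_bijective (R := R) h (v i) (hv i) (ψ i) (hψ i) (hsurj i) (hinj i))
  -- The monoid algebra of `J i →₀ ℕ` is by definition `MvPolynomial (J i) R`; it remains to see
  -- that `Φ` respects the structure map from `R`.
  have hΦ : (Φ.toRingHom.comp ((fromZeroRingHom (gradeBy R h) _).comp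
      (algebraMap R (gradeBy R h 0)))) = algebraMap R (MvPolynomial (J i) R) := by
    ext1 c
    have h0 : single (0 : M) c ∈ gradeBy R h (0 • 1) := by
      simpa using single_mem_gradeBy h 0 c
    have := awayToMonoidAlgebra_mk h (v i) (ψ i) (hψ i) (hd i) 0 (single 0 c) h0
    rw [mapDomain_single, map_zero] at this
    refine Eq.trans ?_ this
    change Φ _ = Φ _
    congr 1
  have hsm : (algebraMap R (MvPolynomial (J i) R)).Smooth :=
    RingHom.smooth_algebraMap.2 ⟨inferInstance, inferInstance⟩
  have key := RingHom.Smooth.comp hsm (RingHom.Smooth.holdsForLocalizationAway.of_bijective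
    Φ.symm.toRingHom RingHom.Smooth Φ.symm.bijective)
  rw [← hΦ] at key
  have hcancel : ∀ g : R →+* Away (gradeBy R h) (single (v i) (1 : R)),
      Φ.symm.toRingHom.comp (Φ.toRingHom.comp g) = g := fun g ↦ by ext c; simp
  rw [hcancel] at key
  exact key

/-! ### Strict submodularity of the sum of truncations -/

theorem truncation_submodular {n : ℕ} {r : Finset (Fin n) → ℕ} (hr : IsPolymatroid r) (k : ℕ)
    (S T : Finset (Fin n)) :
    truncation r k (S ∪ T) + truncation r k (S ∩ T) ≤ truncation r k S + truncation r k T := by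
  have h1 := hr.submodular S T
  have h2 := hr.mono _ _ (Finset.inter_subset_left (s₁ := S) (s₂ := T))
  have h3 := hr.mono _ _ (Finset.inter_subset_right (s₁ := S) (s₂ := T))
  have h4 := hr.mono _ _ (Finset.subset_union_left (s₁ := S) (s₂ := T))
  have h5 := hr.mono _ _ (Finset.subset_union_right (s₁ := S) (s₂ := T))
  simp only [truncation]
  omega

/-- A polymatroid in which submodularity is strict: equality for `S` and `T` forces the pairs of
values at `{S ∩ T, S ∪ T}` and `{S, T}` to agree. -/
structure IsStrictPolymatroid {n : ℕ} (f : Finset (Fin n) → ℕ) : Prop extends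
    IsPolymatroid f where
  strict : ∀ S T : Finset (Fin n), f S + f T = f (S ∪ T) + f (S ∩ T) → f S ≤ f T →
    f (S ∩ T) = f S ∧ f (S ∪ T) = f T

/-- Each truncation is submodular, so equality for the sum forces equality for `min c ∘ r` at every
level `c ≤ d`. Well-chosen levels then recover the values of `r` itself. -/
theorem IsPolymatroid.isStrictPolymatroid_truncationSum {n : ℕ} {r : Finset (Fin n) → ℕ}
    (hr : IsPolymatroid r) : IsStrictPolymatroid (truncationSum r) where
  mono S T h := Finset.sum_le_sum fun k _ ↦ min_le_min_left _ (hr.mono S T h)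
  submodular S T := by
    simp only [truncationSum, ← Finset.sum_add_distrib]
    exact Finset.sum_le_sum fun k _ ↦ truncation_submodular hr k S T
  empty := by simp [truncationSum, truncation, hr.empty]
  strict S T h hST := by
    have hle : r S ≤ r T := by
      by_contra! hlt
      refine absurd hST (not_le.2 ?_)
      -- The term `k = 0` is `r` itself, so it keeps the strict inequality.
      refine Finset.sum_lt_sum (fun k _ ↦ min_le_min_left _ hlt.le) ⟨0, by simp, ?_⟩
      have := hr.mono S _ (Finset.subset_univ S)
      simp only [truncation, polyRank]
      omega
    have heq : ∀ c ≤ polyRank r, min c (r (S ∪ T)) + min c (r (S ∩ T)) =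
        min c (r S) + min c (r T) := by
      intro c hc
      simp only [truncationSum, ← Finset.sum_add_distrib] at h
      have := (Finset.sum_eq_sum_iff_of_le fun k _ ↦ truncation_submodular hr k S T).1 h.symm
        (polyRank r - c) (by simp)
      simp only [truncation] at this
      rwa [Nat.sub_sub_self hc] at this
    have h2 := hr.mono _ _ (Finset.inter_subset_left (s₁ := S) (s₂ := T))
    have h5 := hr.mono _ _ (Finset.subset_union_right (s₁ := S) (s₂ := T))
    -- Level `r S` caps `S`, `T` and `S ∪ T` at the same value, leaving `r (S ∩ T) = r S`; level `r
    -- (S ∪ T)` caps nothing and then gives `r (S ∪ T) = r T`.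
    have e1 := heq (r S) (hr.mono S _ (Finset.subset_univ S))
    have e2 := heq (r (S ∪ T)) (hr.mono _ _ (Finset.subset_univ _))
    have e3 : r (S ∩ T) = r S := by omega
    have e4 : r (S ∪ T) = r T := by omega
    simp only [truncationSum, truncation, e3, e4, and_self]

/-- An integral system of sums over sets `D e ∋ e` that is triangular for a rank function is
uniquely solvable. -/
theorem existsUnique_of_triangular {α : Type*} [DecidableEq α] (D : α → Finset α) (ρ : α → ℕ)
    (hD : ∀ e, e ∈ D e) (hρ : ∀ e, ∀ a ∈ D e, a ≠ e → ρ a < ρ e) (y : α → ℤ) :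
    ∃! x : α → ℤ, ∀ e, ∑ a ∈ D e, x a = y e := by
  have hsplit : ∀ (x : α → ℤ) e, ∑ a ∈ D e, x a = x e + ∑ a ∈ (D e).erase e, x a :=
    fun x e ↦ (Finset.add_sum_erase _ _ (hD e)).symm
  have hlt : ∀ e, ∀ a ∈ (D e).erase e, ρ a < ρ e := fun e a ha ↦
    hρ e a (Finset.mem_of_mem_erase ha) (Finset.ne_of_mem_erase ha)
  let wf := (measure ρ).wf
  let F : ∀ e, (∀ a, ρ a < ρ e → ℤ) → ℤ := fun e ih ↦
    y e - ∑ a ∈ ((D e).erase e).attach, ih a (hlt e a a.2)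
  refine ⟨wf.fix F, fun e ↦ ?_, fun x hx ↦ ?_⟩
  · rw [hsplit, wf.fix_eq F e]
    simp only [F]
    rw [Finset.sum_attach ((D e).erase e) (fun a ↦ wf.fix F a)]
    ring
  · funext e
    induction e using wf.induction with
    | _ e ih =>
      rw [wf.fix_eq F e]
      simp only [F]
      rw [Finset.sum_attach ((D e).erase e) (fun a ↦ wf.fix F a), ← hx e, hsplit,
        Finset.sum_congr rfl fun a ha ↦ (ih a (hlt e a ha)).symm]
      ring

/-! ### Greedy vertices and lattice points of the cone over the base polytope -/

namespace IsPolymatroid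

variable {n : ℕ} {f : Finset (Fin n) → ℕ}

/-- The elements that come before position `i`. -/
def below (p : Equiv.Perm (Fin n)) (i : ℕ) : Finset (Fin n) :=
  Finset.univ.filter fun e ↦ (p e : ℕ) < i

@[simp] theorem mem_below {p : Equiv.Perm (Fin n)} {i : ℕ} {e : Fin n} :
    e ∈ below p i ↔ (p e : ℕ) < i := by simp [below]

theorem below_succ (p : Equiv.Perm (Fin n)) (e : Fin n) :
    below p (p e + 1) = insert e (below p (p e)) := by
  ext a
  simp only [mem_below, Finset.mem_insert, Nat.lt_succ_iff_lt_or_eq]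
  rw [or_comm, ← Fin.ext_iff, p.injective.eq_iff]

theorem below_of_le (p : Equiv.Perm (Fin n)) {i : ℕ} (hi : n ≤ i) :
    below p i = Finset.univ := by
  ext a; simpa using (p a).2.trans_le hi

/-- Induction along the initial segments of a linear order on the ground set. -/
theorem below_induction (p : Equiv.Perm (Fin n)) {motive : Finset (Fin n) → Prop}
    (empty : motive ∅) (step : ∀ e, motive (below p (p e)) → motive (insert e (below p (p e)))) :
    ∀ i, motive (below p i) := by
  intro i
  induction i with
  | zero => convert empty; ext; simp
  | succ i ih =>
    by_cases hi : i < n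
    · have := step (p.symm ⟨i, hi⟩)
      rw [← below_succ] at this
      simp only [Equiv.apply_symm_apply] at this
      exact this ih
    · rwa [below_of_le p (by omega), ← below_of_le p (not_lt.1 hi)]

/-- The greedy vertex of the base polytope attached to an order of the ground set. -/
def vertex (f : Finset (Fin n) → ℕ) (p : Equiv.Perm (Fin n)) (e : Fin n) : ℤ :=
  f (insert e (below p (p e))) - f (below p (p e))

theorem insert_sub_le (hf : IsPolymatroid f) {S T : Finset (Fin n)} (h : S ⊆ T) (e : Fin n) :
    (f (insert e T) : ℤ) - f T ≤ f (insert e S) - f S := by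
  by_cases he : e ∈ T
  · have := hf.mono _ _ (Finset.subset_insert e S)
    rw [Finset.insert_eq_of_mem he]; omega
  · have h1 := hf.submodular (insert e S) T
    rw [Finset.insert_union, Finset.union_eq_right.2 h, Finset.insert_inter_of_notMem he,
      Finset.inter_eq_left.2 h] at h1
    omega

theorem vertex_nonneg (hf : IsPolymatroid f) (p : Equiv.Perm (Fin n)) (e : Fin n) :
    0 ≤ vertex f p e := by
  have := hf.mono _ _ (Finset.subset_insert e (below p (p e)))
  simp only [vertex]; omega

theorem sum_vertex_below (hf : IsPolymatroid f) (p : Equiv.Perm (Fin n)) (i : ℕ) :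
    ∑ e ∈ below p i, vertex f p e = f (below p i) := by
  refine below_induction p (motive := fun B ↦ ∑ e ∈ B, vertex f p e = f B)
    (by simp [hf.empty]) (fun e ih ↦ ?_) i
  rw [Finset.sum_insert (by simp), ih, vertex]; ring

theorem sum_vertex_univ (hf : IsPolymatroid f) (p : Equiv.Perm (Fin n)) :
    ∑ e, vertex f p e = f Finset.univ := by
  simpa [below_of_le p le_rfl] using sum_vertex_below hf p n

/-- Diminishing returns: an element of `T` gains at least as much over `T ∩ B` as over the whole
segment `B`. -/
theorem sum_vertex_le (hf : IsPolymatroid f) (p : Equiv.Perm (Fin n)) (T : Finset (Fin n)) :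
    ∑ e ∈ T, vertex f p e ≤ f T := by
  have := below_induction p (motive := fun B ↦ ∑ e ∈ T ∩ B, vertex f p e ≤ f (T ∩ B))
    (by simp) (fun e ih ↦ ?_) n
  · simpa [below_of_le p le_rfl] using this
  · by_cases he : e ∈ T
    · rw [Finset.inter_insert_of_mem he, Finset.sum_insert (by simp), vertex]
      have := insert_sub_le hf (Finset.inter_subset_right (s₁ := T) (s₂ := below p (p e))) e
      omega
    · rwa [Finset.inter_insert_of_notMem he]

/-- The greedy vertex maximizes linear functionals that are antitone along its order. -/
theorem sum_mul_le_sum_mul_vertex (hf : IsPolymatroid f) (p : Equiv.Perm (Fin n)) {c : Fin n → ℝ}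
    (hc : ∀ a b, p a ≤ p b → c b ≤ c a) {x : Fin n → ℝ}
    (hx : x ∈ basePolytope fun S ↦ (f S : ℝ)) :
    ∑ e, c e * x e ≤ ∑ e, c e * (vertex f p e : ℝ) := by
  obtain ⟨-, hx1, hx2⟩ := hx
  have hw : ∀ i, 0 ≤ ∑ e ∈ below p i, ((vertex f p e : ℝ) - x e) := fun i ↦ by
    have h1 : (∑ e ∈ below p i, (vertex f p e : ℝ)) = f (below p i) := by
      exact_mod_cast sum_vertex_below hf p i
    rw [Finset.sum_sub_distrib, h1]
    linarith [hx1 (below p i)]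
  -- Summation by parts. The lower bound `t` varies so that it can be raised to `c e` on the shorter
  -- segment; the price is `c e - t` times a partial sum, nonnegative by `hw`. At the end `t` drops
  -- out because both points have the same total.
  have key := below_induction p (motive := fun B ↦ ∀ t, (∀ e ∈ B, t ≤ c e) →
    0 ≤ ∑ e ∈ B, (c e - t) * ((vertex f p e : ℝ) - x e)) (by simp) (fun e ih t ht ↦ ?_) n
  · rw [below_of_le p le_rfl] at key
    obtain ⟨t, ht⟩ := (Set.finite_range c).bddBelow
    have h1 := key t fun e _ ↦ ht ⟨e, rfl⟩
    have h2 : (∑ e, (vertex f p e : ℝ)) = f Finset.univ := by exact_mod_cast sum_vertex_univ hf p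
    simp only [sub_mul, mul_sub, Finset.sum_sub_distrib, ← Finset.mul_sum, h2, hx2] at h1
    linarith
  · have h1 := ih (c e) fun a ha ↦ hc a e (by simpa using (mem_below.1 ha).le)
    have h2 := hw (p e + 1)
    rw [below_succ] at h2
    have h3 := mul_nonneg (sub_nonneg.2 (ht e (Finset.mem_insert_self _ _))) h2
    have h4 : ∑ a ∈ insert e (below p (p e)), (c a - t) * ((vertex f p a : ℝ) - x a) =
        ∑ a ∈ below p (p e), (c a - c e) * ((vertex f p a : ℝ) - x a) +
        (c e - t) * ∑ a ∈ insert e (below p (p e)), ((vertex f p a : ℝ) - x a) := by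
      rw [Finset.sum_insert (by simp), Finset.sum_insert (by simp), mul_add, Finset.mul_sum,
        add_left_comm, ← Finset.sum_add_distrib]
      congr 1
      exact Finset.sum_congr rfl fun a _ ↦ by ring
    rw [h4]
    exact add_nonneg h1 h3

theorem convex_basePolytope (g : Finset (Fin n) → ℝ) : Convex ℝ (basePolytope g) := by
  intro x hx y hy a b ha hb hab
  have hsum : ∀ S : Finset (Fin n), ∑ i ∈ S, (a • x + b • y) i =
      a * ∑ i ∈ S, x i + b * ∑ i ∈ S, y i := fun S ↦ by
    simp [Finset.sum_add_distrib, Finset.mul_sum]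
  refine ⟨fun i ↦ ?_, fun S ↦ ?_, ?_⟩
  · have := mul_nonneg ha (hx.1 i)
    have := mul_nonneg hb (hy.1 i)
    simp only [Pi.add_apply, Pi.smul_apply, smul_eq_mul]; linarith
  · rw [hsum]
    have := mul_le_mul_of_nonneg_left (hx.2.1 S) ha
    have := mul_le_mul_of_nonneg_left (hy.2.1 S) hb
    have : a * g S + b * g S = g S := by rw [← add_mul, hab, one_mul]
    linarith
  · rw [hsum, hx.2.2, hy.2.2, ← add_mul, hab, one_mul]

theorem vertex_mem_basePolytope (hf : IsPolymatroid f) (p : Equiv.Perm (Fin n)) :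
    (fun e ↦ (vertex f p e : ℝ)) ∈ basePolytope fun S ↦ (f S : ℝ) :=
  ⟨fun e ↦ Int.cast_nonneg (vertex_nonneg hf p e),
    fun S ↦ by simpa using (Int.cast_le (R := ℝ)).2 (sum_vertex_le hf p S),
    by simpa using congrArg (Int.cast (R := ℝ)) (sum_vertex_univ hf p)⟩

/-- The base polytope is the convex hull of its greedy vertices. -/
theorem basePolytope_eq_convexHull (hf : IsPolymatroid f) :
    basePolytope (fun S ↦ (f S : ℝ)) =
      convexHull ℝ (Set.range fun (p : Equiv.Perm (Fin n)) e ↦ (vertex f p e : ℝ)) := by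
  refine Set.Subset.antisymm (fun x hx ↦ ?_) (convexHull_min ?_ (convex_basePolytope _))
  · by_contra hxn
    obtain ⟨l, u, hl, hu⟩ := geometric_hahn_banach_closed_point (convex_convexHull ℝ _)
      ((Set.finite_range _).isCompact_convexHull ℝ).isClosed hxn
    have hlin : ∀ y : Fin n → ℝ, l y = ∑ e, l (Pi.single e 1) * y e := fun y ↦ by
      conv_lhs => rw [← Finset.univ_sum_single y, map_sum]
      refine Finset.sum_congr rfl fun e _ ↦ ?_
      rw [mul_comm, ← smul_eq_mul, ← map_smul, ← Pi.single_smul, smul_eq_mul, mul_one]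
    set c := fun e ↦ l (Pi.single e 1) with hc
    -- Sorting `-c` lists the coefficients in decreasing order, so the corresponding greedy vertex
    -- contradicts the separation.
    have hs := Tuple.monotone_sort (fun e ↦ - c e)
    have hmax := sum_mul_le_sum_mul_vertex hf (Tuple.sort fun e ↦ - c e).symm (c := c)
      (fun a b hab ↦ by simpa using hs hab) hx
    have h1 := hl _ (subset_convexHull ℝ _ ⟨(Tuple.sort fun e ↦ - c e).symm, rfl⟩)
    rw [hlin] at h1 hu
    linarith
  · rintro _ ⟨p, rfl⟩
    exact vertex_mem_basePolytope hf p

theorem isLatticePolytope_basePolytope (hf : IsPolymatroid f) :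
    IsLatticePolytope (basePolytope fun S ↦ (f S : ℝ)) := by
  refine ⟨Finset.univ.image (vertex f), Finset.univ_nonempty.image _, ?_⟩
  rw [basePolytope_eq_convexHull hf, Finset.coe_image, Finset.coe_univ, Set.image_univ,
    ← Set.range_comp]
  rfl

theorem mem_coneOver_basePolytope {g : Finset (Fin n) → ℝ}
    {y : (Fin n → ℝ) × ℝ} (hy : y ∈ coneOver (basePolytope g)) :
    (∀ i, 0 ≤ y.1 i) ∧ (∀ S : Finset (Fin n), ∑ i ∈ S, y.1 i ≤ y.2 * g S) ∧
      ∑ i, y.1 i = y.2 * g Finset.univ := by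
  induction hy using Submodule.span_induction with
  | mem y hy =>
    obtain ⟨x, hx, rfl⟩ := hy
    simpa [basePolytope] using hx
  | zero => simp
  | add y z _ _ hy hz =>
    refine ⟨fun i ↦ add_nonneg (hy.1 i) (hz.1 i), fun S ↦ ?_, ?_⟩
    · simp only [Prod.fst_add, Prod.snd_add, Pi.add_apply, Finset.sum_add_distrib, add_mul]
      exact add_le_add (hy.2.1 S) (hz.2.1 S)
    · simp only [Prod.fst_add, Prod.snd_add, Pi.add_apply, Finset.sum_add_distrib, add_mul]
      rw [hy.2.2, hz.2.2]
  | smul c y _ hy =>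
    have hc : (0 : ℝ) ≤ c := c.2
    change (∀ i, 0 ≤ (c : ℝ) * y.1 i) ∧ (∀ S : Finset (Fin n), ∑ i ∈ S, (c : ℝ) * y.1 i ≤
      (c : ℝ) * y.2 * g S) ∧ ∑ i, (c : ℝ) * y.1 i = (c : ℝ) * y.2 * g Finset.univ
    simp only [← Finset.mul_sum, mul_assoc]
    exact ⟨fun i ↦ mul_nonneg hc (hy.1 i), fun S ↦ mul_le_mul_of_nonneg_left (hy.2.1 S) hc,
      by rw [hy.2.2]⟩

theorem div_mem_basePolytope {m : Fin n → ℤ} {k : ℕ} (hk : 0 < k) (h1 : ∀ i, 0 ≤ m i)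
    (h2 : ∀ S : Finset (Fin n), ∑ i ∈ S, m i ≤ k * f S)
    (h3 : ∑ i, m i = k * f Finset.univ) :
    (fun i ↦ (m i : ℝ) / k) ∈ basePolytope fun S ↦ (f S : ℝ) := by
  have hk' : (0 : ℝ) < k := by exact_mod_cast hk
  refine ⟨fun i ↦ div_nonneg (by exact_mod_cast h1 i) hk'.le, fun S ↦ ?_, ?_⟩
  · rw [← Finset.sum_div, div_le_iff₀' hk']
    beta_reduce
    exact_mod_cast h2 S
  · rw [← Finset.sum_div, div_eq_iff hk'.ne', mul_comm]
    beta_reduce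
    exact_mod_cast h3

/-- The lattice points of the cone over the base polytope. -/
theorem mem_polytopeMonoid_iff (m : Fin n → ℤ) (k : ℕ) :
    (m, k) ∈ polytopeMonoid (basePolytope fun S ↦ (f S : ℝ)) ↔
      (∀ i, 0 ≤ m i) ∧ (∀ S : Finset (Fin n), ∑ i ∈ S, m i ≤ k * f S) ∧
        ∑ i, m i = k * f Finset.univ := by
  constructor
  · intro h
    obtain ⟨h1, h2, h3⟩ := mem_coneOver_basePolytope h
    simp only [latticeIncl, AddMonoidHom.coe_mk, ZeroHom.coe_mk] at h1 h2 h3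
    exact ⟨fun i ↦ by exact_mod_cast h1 i, fun S ↦ by exact_mod_cast h2 S, by exact_mod_cast h3⟩
  · rintro ⟨h1, h2, h3⟩
    rcases k.eq_zero_or_pos with rfl | hk
    · have hm : m = 0 := by
        funext i
        have h4 := h2 {i}
        have h5 := h1 i
        simp only [Finset.sum_singleton, Nat.cast_zero, zero_mul] at h4
        exact le_antisymm h4 h5
      subst hm
      exact zero_mem _
    · have hk' : (0 : ℝ) < k := by exact_mod_cast hk
      have hmem : (fun i ↦ (m i : ℝ) / k) ∈ basePolytope fun S ↦ (f S : ℝ) :=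
        div_mem_basePolytope hk h1 h2 h3
      have := (coneOver (basePolytope fun S ↦ (f S : ℝ))).smul_mem hk'.le
        (Submodule.subset_span ⟨_, hmem, rfl⟩)
      change latticeIncl n (m, k) ∈ coneOver (basePolytope fun S ↦ (f S : ℝ))
      convert this using 1
      refine Prod.ext (funext fun i ↦ ?_) ?_
      · simp [latticeIncl, mul_div_cancel₀ _ hk'.ne']
      · simp [latticeIncl]

/-- A multiple of every lattice point of positive height can be reduced by a greedy vertex. -/
theorem exists_nsmul_eq_vertex_add (hf : IsPolymatroid f) {m : Fin n → ℤ} {k : ℕ} (hk : k ≠ 0)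
    (h : (m, k) ∈ polytopeMonoid (basePolytope fun S ↦ (f S : ℝ))) :
    ∃ (p : Equiv.Perm (Fin n)) (N : ℕ), 0 < N * k ∧ (N • m - vertex f p, N * k - 1) ∈
      polytopeMonoid (basePolytope fun S ↦ (f S : ℝ)) := by
  have hk' : (0 : ℝ) < k := by exact_mod_cast Nat.pos_of_ne_zero hk
  rw [mem_polytopeMonoid_iff] at h
  obtain ⟨h1, h2, h3⟩ := h
  have hmem : (fun i ↦ (m i : ℝ) / k) ∈ basePolytope fun S ↦ (f S : ℝ) :=
    div_mem_basePolytope (Nat.pos_of_ne_zero hk) h1 h2 h3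
  rw [basePolytope_eq_convexHull hf, mem_convexHull_iff_exists_fintype] at hmem
  obtain ⟨ι, _, w, z, hw, hw1, hz, hx⟩ := hmem
  choose q hq using hz
  obtain ⟨j, -, hj⟩ : ∃ j ∈ Finset.univ, 0 < w j :=
    Finset.exists_lt_of_sum_lt (by simp [hw1])
  -- In `N • m`, the vertex `q j` then has weight `N * k * w j > 1`, so one copy of it can be
  -- removed.
  obtain ⟨N, hN⟩ := exists_nat_gt (1 / (k * w j))
  rw [div_lt_iff₀ (by positivity)] at hN
  have hm : ∀ i, (m i : ℝ) = k * ∑ l, w l * (vertex f (q l) i : ℝ) := fun i ↦ by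
    have := congrFun hx i
    simp only [Finset.sum_apply, Pi.smul_apply, smul_eq_mul, ← hq] at this
    rw [this, mul_div_cancel₀ _ hk'.ne']
  -- To be applied with `a l` the slack of a defining inequality of the polytope at the vertex `q
  -- l`.
  have hpos : ∀ (a : ι → ℝ), (∀ l, 0 ≤ a l) → a j ≤ N * (k * ∑ l, w l * a l) := fun a ha ↦ by
    have h4 : w j * a j ≤ ∑ l, w l * a l :=
      Finset.single_le_sum (f := fun l ↦ w l * a l) (fun l _ ↦ mul_nonneg (hw l) (ha l))
        (Finset.mem_univ j)
    calc a j ≤ (N * (k * w j)) * a j := le_mul_of_one_le_left (ha j) hN.le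
      _ = N * (k * (w j * a j)) := by ring
      _ ≤ _ := by gcongr
  have hNk : 0 < N * k := by
    refine Nat.mul_pos (Nat.pos_of_ne_zero ?_) (Nat.pos_of_ne_zero hk)
    rintro rfl
    simp at hN
    linarith
  refine ⟨q j, N, hNk, ?_⟩
  have hcast : ((N * k - 1 : ℕ) : ℤ) = N * k - 1 := by push_cast [Nat.cast_sub hNk]; ring
  rw [mem_polytopeMonoid_iff, hcast]
  simp only [Pi.sub_apply, Pi.smul_apply]
  simp only [nsmul_eq_mul, Finset.sum_sub_distrib, ← Finset.mul_sum]
  refine ⟨fun i ↦ ?_, fun S ↦ ?_, ?_⟩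
  · have := hpos (fun l ↦ vertex f (q l) i) fun l ↦ Int.cast_nonneg (vertex_nonneg hf (q l) i)
    rw [← hm] at this
    rw [sub_nonneg]
    exact_mod_cast this
  · have := hpos (fun l ↦ (f S : ℝ) - ∑ i ∈ S, (vertex f (q l) i : ℝ)) fun l ↦
      sub_nonneg.2 ((vertex_mem_basePolytope hf (q l)).2.1 S)
    have h4 : (k : ℝ) * ∑ l, w l * ((f S : ℝ) - ∑ i ∈ S, (vertex f (q l) i : ℝ)) =
        k * f S - ∑ i ∈ S, (m i : ℝ) := by
      simp only [hm, mul_sub, Finset.sum_sub_distrib, ← Finset.sum_mul, hw1, one_mul,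
        ← Finset.mul_sum]
      congr 2
      simp only [Finset.mul_sum]
      exact Finset.sum_comm
    rw [h4] at this
    have h5 : (f S : ℤ) - ∑ i ∈ S, vertex f (q j) i ≤ N * (k * f S - ∑ i ∈ S, m i) := by
      exact_mod_cast this
    linarith
  · rw [h3, sum_vertex_univ hf]; ring

end IsPolymatroid

/-! ### Closures of initial segments and chart coordinates at a vertex -/

namespace IsPolymatroid

variable {n : ℕ} {f : Finset (Fin n) → ℕ}

/-- The elements whose addition to `S` does not change the value of `f`. -/
def flatClosure (f : Finset (Fin n) → ℕ) (S : Finset (Fin n)) : Finset (Fin n) :=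
  Finset.univ.filter fun e ↦ f (insert e S) = f S

@[simp] theorem mem_flatClosure {S : Finset (Fin n)} {e : Fin n} :
    e ∈ flatClosure f S ↔ f (insert e S) = f S := by simp [flatClosure]

theorem subset_flatClosure (f : Finset (Fin n) → ℕ) (S : Finset (Fin n)) :
    S ⊆ flatClosure f S := fun e he ↦ by simp [Finset.insert_eq_of_mem he]

/-- An element that gains nothing over `S` gains nothing over a larger set, so the closure can be
built up one element at a time. -/
theorem apply_flatClosure (hf : IsPolymatroid f) (S : Finset (Fin n)) :
    f (flatClosure f S) = f S := by
  have h : ∀ A : Finset (Fin n), A ⊆ flatClosure f S → f (A ∪ S) = f S := by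
    intro A
    induction A using Finset.induction_on with
    | empty => simp
    | insert a A _ ih =>
      intro hA
      have h1 := ih ((Finset.subset_insert a A).trans hA)
      have h2 := mem_flatClosure.1 (hA (Finset.mem_insert_self a A))
      have h3 := insert_sub_le hf (Finset.subset_union_right (s₁ := A) (s₂ := S)) a
      have h4 := hf.mono _ _ (Finset.subset_insert a (A ∪ S))
      rw [Finset.insert_union]
      omega
  have := h _ subset_rfl
  rwa [Finset.union_eq_left.2 (subset_flatClosure f S)] at this

/-- The set of coordinates that are summed in the `e`-th coordinate of the chart at a vertex. -/
def chartSet (f : Finset (Fin n) → ℕ) (p : Equiv.Perm (Fin n)) (e : Fin n) : Finset (Fin n) :=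
  if vertex f p e = 0 then {e} else (flatClosure f (below p (p e)))ᶜ

/-- The elements whose chart coordinate does not vanish identically. -/
def IsChartIndex (f : Finset (Fin n) → ℕ) (p : Equiv.Perm (Fin n)) (e : Fin n) : Prop :=
  if vertex f p e = 0 then 0 < f {e} else 0 < f (below p (p e))

/-- The `e`-th coordinate of the chart at a vertex. -/
def chartCoord (f : Finset (Fin n) → ℕ) (p : Equiv.Perm (Fin n)) (e : Fin n) :
    (Fin n → ℤ) →+ ℤ where
  toFun x := ∑ a ∈ chartSet f p e, x a
  map_zero' := by simp
  map_add' x y := by simp [Finset.sum_add_distrib]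

theorem chartCoord_apply (p : Equiv.Perm (Fin n)) (e : Fin n) (x : Fin n → ℤ) :
    chartCoord f p e x = ∑ a ∈ chartSet f p e, x a := rfl

theorem chartCoord_of_eq_zero {p : Equiv.Perm (Fin n)} {e : Fin n} (he : vertex f p e = 0)
    (x : Fin n → ℤ) : chartCoord f p e x = x e := by
  simp [chartCoord_apply, chartSet, he]

theorem chartCoord_of_ne_zero {p : Equiv.Perm (Fin n)} {e : Fin n} (he : vertex f p e ≠ 0)
    (x : Fin n → ℤ) : chartCoord f p e x =
      ∑ a, x a - ∑ a ∈ flatClosure f (below p (p e)), x a := by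
  rw [chartCoord_apply, chartSet, if_neg he, eq_sub_iff_add_eq, Finset.sum_compl_add_sum]

theorem notMem_flatClosure_below {p : Equiv.Perm (Fin n)} {e a : Fin n}
    (ha : vertex f p a ≠ 0) (hf : IsPolymatroid f) (hea : p e ≤ p a) :
    a ∉ flatClosure f (below p (p e)) := by
  rw [mem_flatClosure]
  intro h
  have h1 : below p (p e) ⊆ below p (p a) := fun b hb ↦
    mem_below.2 ((mem_below.1 hb).trans_le hea)
  have h2 := insert_sub_le hf h1 a
  have h3 := vertex_nonneg hf p a
  simp only [vertex] at ha h3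
  omega

/-- The system is unitriangular: for `vertex f p e ≠ 0`, the complement of the closure contains `e`,
and its other members come later in the order. -/
theorem existsUnique_chartCoord (hf : IsPolymatroid f) (p : Equiv.Perm (Fin n))
    (y : Fin n → ℤ) : ∃! x : Fin n → ℤ, ∀ e, chartCoord f p e x = y e := by
  refine existsUnique_of_triangular (chartSet f p)
    -- Zero coordinates are solved first, then the others from the last in the order to the first;
    -- `n - p e` is positive, so the two kinds do not collide.
    (fun e ↦ if vertex f p e = 0 then 0 else n - p e) (fun e ↦ ?_) (fun e a ha hae ↦ ?_) y
  · by_cases he : vertex f p e = 0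
    · simp [chartSet, he]
    · rw [chartSet, if_neg he, Finset.mem_compl]
      exact notMem_flatClosure_below he hf le_rfl
  · by_cases he : vertex f p e = 0
    · simp [chartSet, he] at ha
      exact absurd ha hae
    · rw [chartSet, if_neg he, Finset.mem_compl] at ha
      have h1 : ¬ (p a : ℕ) < p e := fun h ↦ ha (subset_flatClosure _ _ (mem_below.2 h))
      have h2 : (p a : ℕ) ≠ p e := fun h ↦ hae (p.injective (Fin.ext h))
      have h3 := (p e).2
      rw [if_neg he]
      split_ifs <;> omega

/-- The closure is tight at the vertex because it has the value of a tight segment inside it and the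
coordinates are nonnegative. -/
theorem sum_vertex_flatClosure_below (hf : IsPolymatroid f) (p : Equiv.Perm (Fin n)) (i : ℕ) :
    ∑ a ∈ flatClosure f (below p i), vertex f p a = f (flatClosure f (below p i)) := by
  refine le_antisymm (sum_vertex_le hf p _) ?_
  rw [apply_flatClosure hf, ← sum_vertex_below hf]
  exact Finset.sum_le_sum_of_subset_of_nonneg (subset_flatClosure f _)
    fun a _ _ ↦ vertex_nonneg hf p a

section Monoid

variable {m : Fin n → ℤ} {k : ℕ}

/-- This identifies the chart coordinate with the slack of a defining inequality, whence its
nonnegativity on the monoid. -/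
theorem chartCoord_sub_of_ne_zero (hf : IsPolymatroid f) {p : Equiv.Perm (Fin n)} {e : Fin n}
    (he : vertex f p e ≠ 0) (h3 : ∑ i, m i = k * f Finset.univ) :
    chartCoord f p e (m - k • vertex f p) =
      k * f (flatClosure f (below p (p e))) - ∑ a ∈ flatClosure f (below p (p e)), m a := by
  rw [map_sub, map_nsmul, chartCoord_of_ne_zero he, chartCoord_of_ne_zero he, sum_vertex_univ hf,
    sum_vertex_flatClosure_below hf, h3, nsmul_eq_mul]
  ring

theorem chartCoord_nonneg (hf : IsPolymatroid f) (p : Equiv.Perm (Fin n)) (e : Fin n)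
    (h : (m, k) ∈ polytopeMonoid (basePolytope fun S ↦ (f S : ℝ))) :
    0 ≤ chartCoord f p e (m - k • vertex f p) := by
  obtain ⟨h1, h2, h3⟩ := (mem_polytopeMonoid_iff m k).1 h
  by_cases he : vertex f p e = 0
  · rw [chartCoord_of_eq_zero he]
    simpa [he] using h1 e
  · rw [chartCoord_sub_of_ne_zero hf he h3]
    exact sub_nonneg.2 (h2 _)

theorem chartCoord_eq_zero (hf : IsPolymatroid f) {p : Equiv.Perm (Fin n)} {e : Fin n}
    (he : ¬ IsChartIndex f p e)
    (h : (m, k) ∈ polytopeMonoid (basePolytope fun S ↦ (f S : ℝ))) :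
    chartCoord f p e (m - k • vertex f p) = 0 := by
  obtain ⟨h1, h2, h3⟩ := (mem_polytopeMonoid_iff m k).1 h
  by_cases hv : vertex f p e = 0
  · rw [IsChartIndex, if_pos hv, not_lt, Nat.le_zero] at he
    have h4 := h2 {e}
    rw [Finset.sum_singleton, he] at h4
    rw [chartCoord_of_eq_zero hv]
    simpa [hv] using le_antisymm (by simpa using h4) (h1 e)
  · rw [IsChartIndex, if_neg hv, not_lt, Nat.le_zero] at he
    have h4 := h2 (flatClosure f (below p (p e)))
    rw [chartCoord_sub_of_ne_zero hf hv h3]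
    rw [apply_flatClosure hf, he] at h4 ⊢
    have h5 : 0 ≤ ∑ a ∈ flatClosure f (below p (p e)), m a :=
      Finset.sum_nonneg fun a _ ↦ h1 a
    simp only [Nat.cast_zero, mul_zero] at h4 ⊢
    linarith

end Monoid

/-! ### Inequalities tight at a vertex follow from the chart inequalities -/

/-- A set that is tight at a vertex, and whose first missing element with nonzero coordinate is `e`,
lies in the closure of the segment before `e`. -/
theorem _root_.IsStrictPolymatroid.subset_flatClosure_of_tight (hf : IsStrictPolymatroid f)
    {p : Equiv.Perm (Fin n)} {e : Fin n} {T : Finset (Fin n)}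
    (hT : ∑ a ∈ T, vertex f p a = f T) (he : vertex f p e ≠ 0) (heT : e ∉ T)
    (hmin : ∀ a, p a < p e → vertex f p a ≠ 0 → a ∈ T) :
    T ⊆ flatClosure f (below p (p e)) := by
  have hf' := hf.toIsPolymatroid
  -- Both sets are tight at the vertex, and `f` bounds its sums over their union and intersection,
  -- so submodularity is squeezed to equality.
  have modular : ∀ i, f T + f (below p i) = f (T ∪ below p i) + f (T ∩ below p i) := fun i ↦ by
    have h1 := hf'.submodular T (below p i)
    have h2 := sum_vertex_le hf' p (T ∪ below p i)
    have h3 := sum_vertex_le hf' p (T ∩ below p i)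
    have h4 := Finset.sum_union_inter (s₁ := T) (s₂ := below p i) (f := vertex f p)
    rw [hT, sum_vertex_below hf'] at h4
    omega
  set B := below p (p e) with hB
  have hBe : f B < f (insert e B) := by
    have := vertex_nonneg hf' p e
    simp only [vertex, ← hB] at he this
    omega
  have h1 : f (T ∩ B) = f B := by
    refine le_antisymm (hf'.mono _ _ Finset.inter_subset_right) ?_
    have h2 := sum_vertex_le hf' p (T ∩ B)
    have h3 : ∑ a ∈ T ∩ B, vertex f p a = ∑ a ∈ B, vertex f p a :=
      Finset.sum_subset Finset.inter_subset_right fun a ha ha' ↦ by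
        by_contra hne
        exact ha' (Finset.mem_inter.2 ⟨hmin a (by simpa [hB] using ha) hne, ha⟩)
    rw [h3, sum_vertex_below hf'] at h2
    exact_mod_cast h2
  have h2 := modular (p e + 1)
  rw [below_succ, ← hB] at h2
  have h3 : T ∩ insert e B = T ∩ B := Finset.inter_insert_of_notMem heT
  -- Strictness for `T` and `insert e B`, whose intersection has value `f B`: the smaller of their
  -- two values equals `f B`, and it cannot be that of `insert e B`.
  have h4 : f T = f B := by
    rcases le_total (f T) (f (insert e B)) with h | h
    · have := (hf.strict _ _ h2 h).1
      rw [h3, h1] at this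
      exact this.symm
    · have := (hf.strict (insert e B) T (by rw [add_comm, h2, Finset.union_comm,
        Finset.inter_comm]) h).1
      rw [Finset.inter_comm, h3, h1] at this
      omega
  have h5 := (hf.strict T B (modular (p e)) h4.le).2
  intro a ha
  rw [mem_flatClosure]
  refine le_antisymm ?_ (hf'.mono _ _ (Finset.subset_insert a B))
  rw [← h5]
  exact hf'.mono _ _ (Finset.insert_subset (Finset.mem_union_left _ ha) Finset.subset_union_right)

/-- Among the elements satisfying a property there is one that comes first in the order. -/
theorem exists_first (p : Equiv.Perm (Fin n)) {q : Fin n → Prop} (h : ∃ e, q e) :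
    ∃ e, q e ∧ ∀ a, p a < p e → ¬ q a := by
  classical
  obtain ⟨e, he, hmin⟩ := Finset.exists_min_image (Finset.univ.filter q) p
    (h.imp fun e he ↦ by simpa using he)
  refine ⟨e, by simpa using he, fun a ha hq ↦ ?_⟩
  exact absurd (hmin a (by simpa using hq)) (not_le.2 ha)

/-- The first `e` with nonzero vertex coordinate is not a chart index, since the segment before it
has value zero. Its chart coordinate is the total sum up to elements with `f {a} = 0`, where `x`
vanishes. With no such `e`, all of `f` is zero. -/
theorem sum_eq_zero_of_chartCoord (hf : IsPolymatroid f) {p : Equiv.Perm (Fin n)}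
    {x : Fin n → ℤ} (hx : ∀ e, ¬ IsChartIndex f p e → chartCoord f p e x = 0) :
    ∑ a, x a = 0 := by
  have hloop : ∀ a, f {a} = 0 → x a = 0 := fun a ha ↦ by
    have hv : vertex f p a = 0 := by
      have h1 := insert_sub_le hf (Finset.empty_subset (below p (p a))) a
      have h2 := vertex_nonneg hf p a
      simp only [vertex, insert_empty_eq, hf.empty, ha] at h1 h2 ⊢
      omega
    rw [← chartCoord_of_eq_zero hv x]
    exact hx a (by simp [IsChartIndex, hv, ha])
  by_cases h : ∃ e, vertex f p e ≠ 0
  · obtain ⟨e, he, hmin⟩ := exists_first p h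
    have hB : f (below p (p e)) = 0 := by
      have := sum_vertex_below hf p (p e)
      rw [Finset.sum_eq_zero fun a ha ↦ not_not.1 (hmin a (mem_below.1 ha))] at this
      exact_mod_cast this.symm
    have h1 := hx e (by simp [IsChartIndex, he, hB])
    rw [chartCoord_of_ne_zero he, Finset.sum_eq_zero (s := flatClosure f _), sub_zero] at h1
    · exact h1
    · intro a ha
      refine hloop a (Nat.le_zero.1 ?_)
      rw [← hB, ← mem_flatClosure.1 ha]
      exact hf.mono _ _ (by simp)
  · push Not at h
    have h0 : f Finset.univ = 0 := by
      have := sum_vertex_univ hf p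
      rw [Finset.sum_eq_zero fun a _ ↦ h a] at this
      exact_mod_cast this.symm
    exact Finset.sum_eq_zero fun a _ ↦ hloop a
      (Nat.le_zero.1 (h0 ▸ hf.mono _ _ (Finset.subset_univ _)))

/-- If `T` misses an element with nonzero vertex coordinate, take the first such `e`. Then `T` lies
in the closure before `e` and differs from it only in zero coordinates of the vertex, where `x` is
nonnegative; the sum over the closure is minus the chart coordinate of `e`. Otherwise `T` is
compared with the whole ground set. -/
theorem _root_.IsStrictPolymatroid.sum_nonpos_of_tight (hf : IsStrictPolymatroid f)
    {p : Equiv.Perm (Fin n)} {x : Fin n → ℤ} (hnn : ∀ e, 0 ≤ chartCoord f p e x)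
    (hx : ∀ e, ¬ IsChartIndex f p e → chartCoord f p e x = 0) {T : Finset (Fin n)}
    (hT : ∑ a ∈ T, vertex f p a = f T) : ∑ a ∈ T, x a ≤ 0 := by
  have hf' := hf.toIsPolymatroid
  have hnn' : ∀ a, vertex f p a = 0 → 0 ≤ x a := fun a ha ↦ by
    rw [← chartCoord_of_eq_zero ha x]; exact hnn a
  have huniv := sum_eq_zero_of_chartCoord hf' hx
  by_cases h : ∃ e, vertex f p e ≠ 0 ∧ e ∉ T
  · obtain ⟨e, ⟨he, heT⟩, hmin⟩ := exists_first p h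
    have hmin' : ∀ a, p a < p e → vertex f p a ≠ 0 → a ∈ T := fun a ha hv ↦ by
      by_contra haT
      exact hmin a ha ⟨hv, haT⟩
    have hsub := hf.subset_flatClosure_of_tight hT he heT hmin'
    refine (Finset.sum_le_sum_of_subset_of_nonneg hsub fun a ha haT ↦ hnn' a ?_).trans ?_
    · by_contra hv
      refine haT (hmin' a ?_ hv)
      by_contra! hle
      exact notMem_flatClosure_below hv hf' hle ha
    · have := hnn e
      rw [chartCoord_of_ne_zero he, huniv] at this
      linarith
  · push Not at h
    rw [← huniv]
    exact Finset.sum_le_sum_of_subset_of_nonneg (Finset.subset_univ T) fun a _ haT ↦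
      hnn' a (by by_contra hv; exact haT (h a hv))

/-- Every vector with nonnegative chart coordinates, zero outside the chart indices, comes from a
lattice point of the cone. -/
theorem _root_.IsStrictPolymatroid.exists_add_nsmul_vertex_mem (hf : IsStrictPolymatroid f)
    {p : Equiv.Perm (Fin n)} {x : Fin n → ℤ} (hnn : ∀ e, 0 ≤ chartCoord f p e x)
    (hx : ∀ e, ¬ IsChartIndex f p e → chartCoord f p e x = 0) :
    ∃ k : ℕ, (x + k • vertex f p, k) ∈ polytopeMonoid (basePolytope fun S ↦ (f S : ℝ)) := by
  have hf' := hf.toIsPolymatroid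
  -- Here `c` is the slack of an inequality at the vertex: positive slack wins for large `k`, and
  -- only the tight case `c = 0` constrains `x`.
  have hlarge : ∀ c d : ℤ, 0 ≤ c → (c = 0 → d ≤ 0) →
      ∀ᶠ k : ℕ in Filter.atTop, d ≤ k * c := fun c d hc hd ↦ by
    filter_upwards [Filter.eventually_ge_atTop d.toNat] with k hk
    rcases hc.eq_or_lt with rfl | hc
    · simpa using hd rfl
    · nlinarith [Int.self_le_toNat d]
  have h1 : ∀ᶠ k : ℕ in Filter.atTop, ∀ i, - x i ≤ k * vertex f p i :=
    Filter.eventually_all.2 fun i ↦ hlarge _ _ (vertex_nonneg hf' p i) fun hi ↦ by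
      have := hnn i
      rw [chartCoord_of_eq_zero hi] at this
      linarith
  have h2 : ∀ᶠ k : ℕ in Filter.atTop, ∀ S : Finset (Fin n),
      ∑ i ∈ S, x i ≤ k * (f S - ∑ i ∈ S, vertex f p i) :=
    Filter.eventually_all.2 fun S ↦ hlarge _ _ (sub_nonneg.2 (sum_vertex_le hf' p S)) fun hS ↦
      hf.sum_nonpos_of_tight hnn hx (sub_eq_zero.1 hS).symm
  obtain ⟨k, hk1, hk2⟩ := (h1.and h2).exists
  refine ⟨k, (mem_polytopeMonoid_iff _ _).2 ⟨fun i ↦ ?_, fun S ↦ ?_, ?_⟩⟩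
  · have := hk1 i
    rw [Pi.add_apply, Pi.smul_apply, nsmul_eq_mul]
    linarith
  · have := hk2 S
    simp only [Pi.add_apply, Pi.smul_apply, Finset.sum_add_distrib, ← Finset.smul_sum]
    rw [nsmul_eq_mul]
    linarith
  · simp only [Pi.add_apply, Pi.smul_apply, Finset.sum_add_distrib, ← Finset.smul_sum]
    rw [nsmul_eq_mul, sum_vertex_univ hf', sum_eq_zero_of_chartCoord hf' hx, zero_add]

/-! ### The free chart at a vertex and the conclusion -/

/-- The coordinates of the affine chart of the toric variety at a greedy vertex. -/
noncomputable def chart (hf : IsPolymatroid f) (p : Equiv.Perm (Fin n)) :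
    polytopeMonoid (basePolytope fun S ↦ (f S : ℝ)) →+ ({e // IsChartIndex f p e} →₀ ℕ) where
  toFun z := Finsupp.equivFunOnFinite.symm fun e ↦
    (chartCoord f p e (z.1.1 - z.1.2 • vertex f p)).toNat
  map_zero' := by ext; simp
  map_add' z w := by
    ext e
    have hz := chartCoord_nonneg hf p e z.2
    have hw := chartCoord_nonneg hf p e w.2
    simp only [Finsupp.equivFunOnFinite_symm_apply_apply, Finsupp.add_apply]
    rw [← Int.toNat_add hz hw, ← map_add]
    congr 2
    simp only [AddSubmonoid.coe_add, Prod.fst_add, Prod.snd_add, add_smul]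
    abel

theorem coe_chart (hf : IsPolymatroid f) (p : Equiv.Perm (Fin n))
    (z : polytopeMonoid (basePolytope fun S ↦ (f S : ℝ))) (e : {e // IsChartIndex f p e}) :
    (chart hf p z e : ℤ) = chartCoord f p e (z.1.1 - z.1.2 • vertex f p) :=
  Int.toNat_of_nonneg (chartCoord_nonneg hf p e z.2)

theorem chart_injective_of_height (hf : IsPolymatroid f) (p : Equiv.Perm (Fin n))
    (z w : polytopeMonoid (basePolytope fun S ↦ (f S : ℝ)))
    (hh : heightHom _ z = heightHom _ w) (h : chart hf p z = chart hf p w) : z = w := by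
  have hh' : z.1.2 = w.1.2 := hh
  refine Subtype.ext (Prod.ext ?_ hh')
  have h1 : z.1.1 - z.1.2 • vertex f p = w.1.1 - w.1.2 • vertex f p := by
    refine (existsUnique_chartCoord hf p _).unique (fun e ↦ ?_) fun e ↦ rfl
    by_cases he : IsChartIndex f p e
    · rw [← coe_chart hf p z ⟨e, he⟩, ← coe_chart hf p w ⟨e, he⟩, h]
    · rw [chartCoord_eq_zero hf he z.2, chartCoord_eq_zero hf he w.2]
  rw [hh'] at h1
  exact sub_left_injective h1

/-- Extend `y` by zero outside the chart indices, solve the triangular system over the integers, and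
move the solution into the cone by adding a multiple of the vertex, which the chart does not see. -/
theorem _root_.IsStrictPolymatroid.chart_surjective (hf : IsStrictPolymatroid f)
    (p : Equiv.Perm (Fin n)) : Function.Surjective (chart hf.toIsPolymatroid p) := by
  classical
  intro y
  obtain ⟨x, hx, -⟩ := existsUnique_chartCoord hf.toIsPolymatroid p
    fun e ↦ if he : IsChartIndex f p e then (y ⟨e, he⟩ : ℤ) else 0
  obtain ⟨k, hk⟩ := hf.exists_add_nsmul_vertex_mem (p := p) (x := x)
    (fun e ↦ by rw [hx]; split_ifs <;> simp) (fun e he ↦ by rw [hx, dif_neg he])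
  refine ⟨⟨_, hk⟩, ?_⟩
  ext e
  have := coe_chart hf.toIsPolymatroid p ⟨_, hk⟩ e
  rw [add_sub_cancel_right, hx, dif_pos e.2] at this
  exact_mod_cast this

theorem vertex_mem_polytopeMonoid (hf : IsPolymatroid f) (p : Equiv.Perm (Fin n)) :
    (vertex f p, 1) ∈ polytopeMonoid (basePolytope fun S ↦ (f S : ℝ)) :=
  (mem_polytopeMonoid_iff _ _).2 ⟨vertex_nonneg hf p, by simpa using sum_vertex_le hf p,
    by simpa using sum_vertex_univ hf p⟩

/-- The base polytope of a strict polymatroid is smooth. -/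
theorem _root_.IsStrictPolymatroid.isSmoothLatticePolytope (hf : IsStrictPolymatroid f) :
    IsSmoothLatticePolytope (basePolytope fun S ↦ (f S : ℝ)) where
  lattice := isLatticePolytope_basePolytope hf.toIsPolymatroid
  smooth := by
    refine AddMonoidAlgebra.smooth_proj_gradeBy (heightHom _)
      (fun p ↦ ⟨_, vertex_mem_polytopeMonoid hf.toIsPolymatroid p⟩) (fun p ↦ rfl)
      (fun z hz ↦ ?_) (fun p ↦ {e // IsChartIndex f p e}) (chart hf.toIsPolymatroid)
      (fun p ↦ ?_) hf.chart_surjective (chart_injective_of_height hf.toIsPolymatroid)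
    · obtain ⟨p, N, hN, hmem⟩ := exists_nsmul_eq_vertex_add hf.toIsPolymatroid hz z.2
      refine ⟨p, N, ⟨_, hmem⟩, Subtype.ext (Prod.ext ?_ ?_)⟩
      · simp
      · exact (Nat.add_sub_cancel' hN).symm
    · ext e
      have := coe_chart hf.toIsPolymatroid p ⟨_, vertex_mem_polytopeMonoid hf.toIsPolymatroid p⟩ e
      simpa using this

end IsPolymatroid

theorem mainTheorem4 (n : ℕ) (r : Finset (Fin n) → ℕ) (hr : IsPolymatroid r) :
    IsSmoothLatticePolytope (basePolytope (fun S => (truncationSum r S : ℝ))) :=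
  hr.isStrictPolymatroid_truncationSum.isSmoothLatticePolytope
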